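/- Let $F$ be a field with $\operatorname{char}(F)\neq 2,3$, and let $A$ be a finite-dimensional semisimple (associative) algebra over $F$; such an algebra automatically has an identity element $1$. Let $[A,A]$ denote the $F$-linear span of all commutators $xy-yx$ with $x,y\in A$, and let $M(A)$, the multiplication algebra of $A$, be the algebra of all linear maps $A\to A$ of the form $x\mapsto\sum_{i} a_i x b_i$ (finite sum) with $a_i,b_i\in A$. A Jordan automorphism of $A$ is a bijective $F$-linear map $J:A\to A$ with $J(xy+yx)=J(x)J(y)+J(y)J(x)$ for all $x,y\in A$. For every $F$-linear map $T:A\to A$ the following conditions are equivalent: (i) $T(x)^3-x^3\in[A,A]$ for every $x\in A$; (ii) there exist a Jordan automorphism $J$ of $A$ belonging to $M(A)$ and an element $\alpha$ of the center of $A$ with $\alpha^3=1$ such that $T(x)=\alpha J(x)$ for all $x\in A$. -/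

import Mathlib

/-- `[A, A]`: the `F`-linear span of all commutators `x * y - y * x` in `A`. -/
def commutatorSpan (F A : Type*) [Field F] [Ring A] [Algebra F A] : Submodule F A :=
  Submodule.span F {z : A | ∃ x y : A, z = x * y - y * x}

/-- A Jordan automorphism of `A`: a bijective linear map that preserves the
Jordan product `x * y + y * x`. -/
structure IsJordanAutomorphism {F A : Type*} [Field F] [Ring A] [Algebra F A]
    (J : A →ₗ[F] A) : Prop where
  bijective : Function.Bijective J
  map_jordan : ∀ x y : A, J (x * y + y * x) = J x * J y + J y * J x

/-- The multiplication algebra `M(A)`: all linear maps `x ↦ ∑ i, a i * x * b i`, that is, the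
image of `A ⊗ Aᵐᵒᵖ` in `End A` under `a ⊗ b ↦ (x ↦ a * x * b)`. -/
def multiplicationAlgebra (F A : Type*) [Field F] [Ring A] [Algebra F A] :
    Subalgebra F (Module.End F A) :=
  (AlgHom.mulLeftRight F A).range

/-- The elementwise description of the multiplication algebra. -/
theorem mem_multiplicationAlgebra_iff {F A : Type*} [Field F] [Ring A] [Algebra F A]
    (f : A →ₗ[F] A) :
    f ∈ multiplicationAlgebra F A ↔
      ∃ (n : ℕ) (a b : Fin n → A), ∀ x : A, f x = ∑ i, a i * x * b i := by
  constructor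
  · rintro ⟨t, rfl⟩
    induction t using TensorProduct.induction_on with
    | zero => exact ⟨0, Fin.elim0, Fin.elim0, fun x => by simp⟩
    | tmul a b =>
      refine ⟨1, fun _ => a, fun _ => b.unop, fun x => ?_⟩
      simp
    | add s t hs ht =>
      obtain ⟨n, a, b, h⟩ := hs
      obtain ⟨m, c, d, k⟩ := ht
      refine ⟨n + m, Fin.append a c, Fin.append b d, fun x => ?_⟩
      have h' := h x
      have k' := k x
      simp only [AlgHom.toRingHom_eq_coe, RingHom.coe_coe] at h' k' ⊢
      rw [map_add, LinearMap.add_apply, h', k', Fin.sum_univ_add]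
      simp
  · rintro ⟨n, a, b, h⟩
    refine ⟨∑ i, TensorProduct.tmul F (a i) (MulOpposite.op (b i)), ?_⟩
    ext x
    simp [h x]

/-!
Write `C` for `commutatorSpan F A`. Everything rests on the pairing `(x, y) ↦ x * y` modulo `C`.
It is associative and symmetric, `C` is stable under multiplication by central elements, and the
pairing is nondegenerate (`eq_zero_of_forall_mul_mem_commutatorSpan`). For a central simple
algebra over `K` the latter is seen after scalar extension to the algebraic closure of `K`, where
the algebra becomes a matrix algebra and the pairing becomes the trace form.

Let `T` preserve cubes modulo `C`. As `2` and `3` are invertible, the condition polarizes to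
`(T x * T y + T y * T x) * T z ≡ (x * y + y * x) * z`. With `a = T 1`, nondegeneracy yields, one
after the other: `T` is bijective, `T` is linear over the center, Jordan multiplication by `a` is
injective, and `2 * (T x * T y + T y * T x) = a * T (x * y + y * x) + T (x * y + y * x) * a`.
The last identity passes to the split matrix algebra. There `w * w = 1` gives
`T w * T w = a * a`, so `T w` commutes with `a * a`; as the involutions span a matrix algebra and
`T` is surjective, `a * a` is central (`commute_sq_of_jordan_factor`). Then
`a * [a, y] + [a, y] * a = [a * a, y] = 0` and injectivity of Jordan multiplication by `a` make
`a` central. So `J = a⁻¹ * T` is a Jordan automorphism. It is linear over the center, and by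
Jacobson density all such maps lie in the multiplication algebra.

The remaining ingredient, used for `a ^ 3 = 1` and for the converse, is `J x ≡ x` modulo `C` for a
Jordan automorphism `J` that is linear over the center (`sub_mem_commutatorSpan_of_jordan`). After
splitting this says that `J` preserves the trace: it sends a diagonal matrix unit `e` to an
idempotent `p` with `p * w * p` always a multiple of `p`, hence of rank one, and an off-diagonal
matrix unit to an element of square zero.
-/

open scoped TensorProduct

/-! ### Multiplication algebras of central simple algebras -/

theorem mul_mul_mem_multiplicationAlgebra {F A : Type*} [Field F] [Ring A] [Algebra F A]
    (a b : A) : (LinearMap.mulLeft F a ∘ₗ LinearMap.mulRight F b : A →ₗ[F] A) ∈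
      multiplicationAlgebra F A :=
  (mem_multiplicationAlgebra_iff _).2 ⟨1, fun _ => a, fun _ => b, fun x => by simp [mul_assoc]⟩

/-- A simple algebra is a simple module over its multiplication algebra, because the submodules
are the two-sided ideals. -/
theorem isSimpleModule_multiplicationAlgebra (K B : Type*) [Field K] [Ring B] [Algebra K B]
    [IsSimpleRing B] : IsSimpleModule (multiplicationAlgebra K B) B := by
  rw [isSimpleModule_iff_toSpanSingleton_surjective]
  refine ⟨inferInstance, fun x hx y => ?_⟩
  let N := LinearMap.range (LinearMap.toSpanSingleton (multiplicationAlgebra K B) B x)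
  have hN (c d z : B) (hz : z ∈ N) : c * z * d ∈ N := by
    have := N.smul_mem ⟨_, mul_mul_mem_multiplicationAlgebra (F := K) c d⟩ hz
    simpa [Subalgebra.smul_def, mul_assoc] using this
  let I : TwoSidedIdeal B := TwoSidedIdeal.mk' (N : Set B) N.zero_mem N.add_mem
    (fun {z} hz => by simpa using hN (-1) 1 z hz)
    (fun {c z} hz => by simpa using hN c 1 z hz) (fun {z d} hz => by simpa using hN 1 d z hz)
  have hmem (z : B) : z ∈ I ↔ z ∈ N := TwoSidedIdeal.mem_mk' ..
  have h1 : (1 : B) ∈ I := IsSimpleRing.one_mem_of_ne_zero_mem I hx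
    ((hmem x).2 ⟨1, by simp⟩)
  have hy : y ∈ I := by simpa using I.mul_mem_left y 1 h1
  exact (hmem y).1 hy

/-- By Jacobson density, every linear endomorphism of a finite-dimensional central simple algebra
lies in the multiplication algebra. -/
theorem mem_multiplicationAlgebra_of_isCentral {K B : Type*} [Field K] [Ring B] [Algebra K B]
    [IsSimpleRing B] [Algebra.IsCentral K B] [FiniteDimensional K B] (f : B →ₗ[K] B) :
    f ∈ multiplicationAlgebra K B := by
  have := isSimpleModule_multiplicationAlgebra K B
  -- An endomorphism of the bimodule `B` is multiplication by a central element, that is, a scalar.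
  have hg (g : Module.End (multiplicationAlgebra K B) B) : ∃ k : K, ∀ x, g x = k • x := by
    have hl (x y : B) : g (x * y) = x * g y := by
      simpa [Subalgebra.smul_def] using
        g.map_smul ⟨_, mul_mul_mem_multiplicationAlgebra (F := K) x 1⟩ y
    have hr (x y : B) : g (x * y) = g x * y := by
      simpa [Subalgebra.smul_def] using
        g.map_smul ⟨_, mul_mul_mem_multiplicationAlgebra (F := K) 1 y⟩ x
    obtain ⟨k, hk⟩ := Algebra.IsCentral.mem_center_iff K (x := g 1) |>.1
      (Subalgebra.mem_center_iff.2 fun x => by rw [← hl, ← hr, mul_one, one_mul])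
    exact ⟨k, fun x => by rw [Algebra.smul_def, ← hk, ← hr, one_mul]⟩
  let f' : Module.End (Module.End (multiplicationAlgebra K B) B) B :=
    { toFun := f
      map_add' := f.map_add
      map_smul' := fun g x => by
        obtain ⟨k, hk⟩ := hg g
        simp [hk] }
  let b := Module.finBasis K B
  classical
  obtain ⟨r, hr⟩ := jacobson_density (R := multiplicationAlgebra K B) f' (Finset.univ.image b)
  have : f = r.1 := b.ext fun i => hr (b i) (by simp)
  rw [this]
  exact r.2

/-! ### Splitting a central simple algebra -/

/-- Scalar extension keeps a finite-dimensional central simple algebra simple: a linear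
endomorphism of the algebra, extended to the tensor product, preserves two-sided ideals, and a
suitable one sends a given nonzero element to a nonzero scalar. -/
theorem isSimpleRing_tensorProduct (K L B : Type*) [Field K] [Field L] [Algebra K L] [Ring B]
    [Algebra K B] [IsSimpleRing B] [Algebra.IsCentral K B] [FiniteDimensional K B] :
    IsSimpleRing (L ⊗[K] B) := by
  refine .of_eq_bot_or_eq_top fun I => or_iff_not_imp_left.2 fun hI => ?_
  obtain ⟨x, hxI, hx⟩ := SetLike.exists_of_lt (bot_lt_iff_ne_bot.2 hI)
  have hx : x ≠ 0 := hx
  let b := Module.finBasis K B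
  obtain ⟨i, hi⟩ : ∃ i, (Algebra.TensorProduct.basis L b).repr x i ≠ 0 := by
    by_contra! h
    exact hx ((Algebra.TensorProduct.basis L b).repr.injective (by ext i; simp [h i]))
  have hclosed (f : B →ₗ[K] B) (y : L ⊗[K] B) (hy : y ∈ I) : f.baseChange L y ∈ I := by
    obtain ⟨n, a, c, h⟩ := (mem_multiplicationAlgebra_iff f).1
      (mem_multiplicationAlgebra_of_isCentral f)
    have : f.baseChange L y = ∑ j, (1 ⊗ₜ[K] a j) * y * (1 ⊗ₜ[K] c j) := by
      clear hy
      induction y with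
      | zero => simp
      | tmul l z => simp [h, TensorProduct.tmul_sum]
      | add y z hy hz => simp [hy, hz, mul_add, add_mul, Finset.sum_add_distrib]
    rw [this]
    exact sum_mem fun j _ => I.mul_mem_right _ _ (I.mul_mem_left _ _ hy)
  have key (y : L ⊗[K] B) : ((b.coord i).smulRight (1 : B)).baseChange L y =
      ((Algebra.TensorProduct.basis L b).repr y i) ⊗ₜ[K] (1 : B) := by
    induction y with
    | zero => simp
    | tmul l z => 
      simp only [LinearMap.baseChange_tmul, LinearMap.smulRight_apply, Module.Basis.coord_apply,
        Algebra.TensorProduct.basis_repr_tmul, TensorProduct.tmul_smul, TensorProduct.smul_tmul']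
      simp [Algebra.smul_def, mul_comm]
    | add y z hy hz => simp [hy, hz, TensorProduct.add_tmul]
  have h1 := hclosed ((b.coord i).smulRight (1 : B)) x hxI
  rw [key] at h1
  have h2 := I.mul_mem_left (((Algebra.TensorProduct.basis L b).repr x i)⁻¹ ⊗ₜ[K] (1 : B)) _ h1
  rw [Algebra.TensorProduct.tmul_mul_tmul, inv_mul_cancel₀ hi, one_mul,
    ← Algebra.TensorProduct.one_def] at h2
  exact (TwoSidedIdeal.one_mem_iff I).1 h2

theorem exists_algEquiv_tensorProduct_matrix (K B : Type*) [Field K] [Ring B] [Algebra K B]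
    [IsSimpleRing B] [Algebra.IsCentral K B] [FiniteDimensional K B] :
    ∃ n : ℕ, Nonempty (AlgebraicClosure K ⊗[K] B ≃ₐ[AlgebraicClosure K]
      Matrix (Fin n) (Fin n) (AlgebraicClosure K)) := by
  have := isSimpleRing_tensorProduct K (AlgebraicClosure K) B
  obtain ⟨n, -, h⟩ := IsSimpleRing.exists_algEquiv_matrix_of_isAlgClosed
    (AlgebraicClosure K) (AlgebraicClosure K ⊗[K] B)
  exact ⟨n, h⟩

/-! ### Matrix algebras -/

/-- A nonzero idempotent `p` with `p * w * p` always a multiple of `p` has rank one, hence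
trace one. -/
theorem Matrix.trace_eq_one_of_corner {n L : Type*} [Fintype n] [Field L]
    {p : Matrix n n L} (hp : p * p = p) (hp0 : p ≠ 0)
    (h : ∀ w, ∃ s : L, p * w * p = s • p) : p.trace = 1 := by
  classical
  obtain ⟨l, k, hlk⟩ : ∃ l k, p l k ≠ 0 := by
    by_contra! h0
    exact hp0 (by ext i j; simp [h0])
  obtain ⟨s, hs⟩ := h (Matrix.single k l 1)
  have h1 : p l k * p l k = s * p l k := by
    have := congr_fun (congr_fun hs l) k
    simpa [Matrix.mul_apply, Matrix.single_apply, ite_and, Finset.sum_ite_eq] using this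
  have h2 : p l k = s * p.trace := by
    have := congr_arg Matrix.trace hs
    rw [Matrix.trace_mul_comm, ← mul_assoc, hp, Matrix.trace_smul, Matrix.trace_mul_single] at this
    simpa using this
  have h3 : p l k = s := mul_right_cancel₀ hlk h1
  rw [← h3] at h2
  exact (mul_eq_left₀ hlk).1 h2.symm

/-- Every linear functional on matrices that vanishes on commutators is a multiple of the trace. -/
theorem Matrix.exists_eq_mul_trace {n L : Type*} [Fintype n] [Field L]
    (f : Matrix n n L →ₗ[L] L) (hf : ∀ x y, f (x * y) = f (y * x)) :
    ∃ c : L, ∀ x, f x = c * x.trace := by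
  classical
  rcases isEmpty_or_nonempty n with _ | ⟨⟨i₀⟩⟩
  · exact ⟨0, fun x => by simp [Subsingleton.elim x 0]⟩
  refine ⟨f (Matrix.single i₀ i₀ 1), fun x => ?_⟩
  have hs (i j : n) : f (Matrix.single i j 1) = if i = j then f (Matrix.single i₀ i₀ 1) else 0 := by
    have h1 := hf (Matrix.single i i₀ 1) (Matrix.single i₀ j 1)
    split_ifs with hij
    · subst hij
      simpa using h1
    · rwa [Matrix.single_mul_single_same, Matrix.single_mul_single_of_ne _ _ _ _ (Ne.symm hij),
        map_zero, mul_one] at h1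
  have hs' (i j : n) : f (Matrix.single i j (x i j)) =
      if i = j then x i i * f (Matrix.single i₀ i₀ 1) else 0 := by
    have : Matrix.single i j (x i j) = x i j • Matrix.single i j (1 : L) := by simp
    rw [this, map_smul, hs]
    split_ifs with hij <;> simp [hij]
  conv_lhs => rw [Matrix.matrix_eq_sum_single x]
  simp [map_sum, hs', Matrix.trace, mul_comm (f _), Finset.sum_mul]

/-- In characteristic other than two, a bijective Jordan homomorphism of a matrix algebra preserves
the trace. -/
theorem Matrix.trace_map_jordan {n L : Type*} [Fintype n] [Field L] (h2 : (2 : L) ≠ 0)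
    (J : Matrix n n L →ₗ[L] Matrix n n L) (hJ : Function.Bijective J)
    (hmul : ∀ x y, J (x * y + y * x) = J x * J y + J y * J x) (x : Matrix n n L) :
    (J x).trace = x.trace := by
  classical
  have hidem (e : Matrix n n L) (he : e * e = e) : J e * J e = J e := by
    have := hmul e e
    rw [he, ← two_smul L, ← two_smul L, map_smul] at this
    exact (smul_right_injective _ h2 this).symm
  have hcorner (e : Matrix n n L) (he : e * e = e) (y : Matrix n n L) :
      J e * J y * J e = J (e * y * e) := by
    have h1 := hmul e (e * y + y * e)
    have h3 : e * (e * y + y * e) + (e * y + y * e) * e = e * y + y * e + (2 : L) • (e * y * e) := by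
      rw [two_smul]
      linear_combination (norm := noncomm_ring) he * y + y * he
    rw [h3, map_add, map_smul, hmul] at h1
    have h4 : (2 : L) • J (e * y * e) = (2 : L) • (J e * J y * J e) := by
      rw [two_smul L (J e * _ * _)]
      linear_combination (norm := noncomm_ring) h1 + hidem e he * J y + J y * hidem e he
    exact (smul_right_injective _ h2 h4).symm
  have hdiag (i : n) : (J (Matrix.single i i 1)).trace = 1 := by
    have he : Matrix.single i i (1 : L) * Matrix.single i i 1 = Matrix.single i i 1 := by simp
    refine Matrix.trace_eq_one_of_corner (hidem _ he) ?_ fun w => ?_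
    · rw [Ne, map_eq_zero_iff J hJ.1]
      exact fun h => one_ne_zero (α := L) (by simpa using congr_fun (congr_fun h i) i)
    · obtain ⟨y, rfl⟩ := hJ.2 w
      refine ⟨y i i, ?_⟩
      rw [hcorner _ he, ← map_smul]
      simp
  have hoff (i j : n) (hij : i ≠ j) : (J (Matrix.single i j 1)).trace = 0 := by
    have h0 : Matrix.single i j (1 : L) * Matrix.single i j 1 = 0 := by simp [hij.symm]
    have h1 := hmul (Matrix.single i j 1) (Matrix.single i j 1)
    rw [h0, add_zero, map_zero, ← two_smul L] at h1
    have h3 := (smul_eq_zero.1 h1.symm).resolve_left h2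
    exact (Matrix.isNilpotent_trace_of_isNilpotent ⟨2, by rw [sq, h3]⟩).eq_zero
  have hlin : Matrix.traceLinearMap n L L ∘ₗ J = Matrix.traceLinearMap n L L := by
    refine Matrix.ext_linearMap _ fun i j => ?_
    ext
    by_cases hij : i = j
    · subst hij
      simp [hdiag]
    · simp [hij, hoff i j hij]
  exact LinearMap.congr_fun hlin x

/-- If `T` multiplies Jordan products by a fixed factor `a`, then `T w ^ 2 = a ^ 2` for every
involution `w`, so `a ^ 2` commutes with `T w`. Involutions span the matrix algebra. -/
theorem Matrix.commute_sq_of_jordan_factor {n L : Type*} [Fintype n] [DecidableEq n] [Field L]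
    (h2 : (2 : L) ≠ 0) (T : Matrix n n L →ₗ[L] Matrix n n L)
    (hT : ∀ x y, 2 * (T x * T y + T y * T x) = T 1 * T (x * y + y * x) + T (x * y + y * x) * T 1)
    (x : Matrix n n L) : Commute (T 1 * T 1) (T x) := by
  -- An involution `w` is a square root of `1`, so its image is a square root of `T 1 * T 1`.
  have hinv (w : Matrix n n L) (hw : w * w = 1) : T w * T w = T 1 * T 1 := by
    have h := hT w w
    rw [hw, map_add] at h
    have : (4 : L) • (T w * T w) = (4 : L) • (T 1 * T 1) := by
      simp only [ofNat_smul_eq_nsmul]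
      linear_combination (norm := noncomm_ring) h
    exact smul_right_injective _ (by
      have := mul_ne_zero h2 h2
      norm_num at this
      exact this) this
  have hcomm (e : Matrix n n L) (he : e * e = e) : Commute (T 1 * T 1) (T e) := by
    have h1 : Commute (T 1 * T 1) (T ((2 : L) • e - 1)) := by
      rw [← hinv ((2 : L) • e - 1)]
      · exact (Commute.refl _).mul_left (Commute.refl _)
      · rw [two_smul]
        linear_combination (norm := noncomm_ring) 4 * he
    have h3 : Commute (T 1 * T 1) (T 1) := (Commute.refl _).mul_left (Commute.refl _)
    have h4 : T e = (2 : L)⁻¹ • (T ((2 : L) • e - 1) + T 1) := by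
      rw [← map_add, sub_add_cancel, map_smul, inv_smul_smul₀ h2]
    rw [h4]
    exact (h1.add_right h3).smul_right _
  have hdiag (i : n) : Commute (T 1 * T 1) (T (Matrix.single i i 1)) := hcomm _ (by simp)
  have hsingle (i j : n) : Commute (T 1 * T 1) (T (Matrix.single i j 1)) := by
    by_cases hij : i = j
    · exact hij ▸ hdiag i
    -- `single i j 1` is a difference of idempotents.
    have h1 := hcomm (Matrix.single i i 1 + Matrix.single i j 1)
      (by simp [mul_add, add_mul, Ne.symm hij])
    have h3 := h1.sub_right (hdiag i)
    rwa [← map_sub, add_sub_cancel_left] at h3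
  rw [Matrix.matrix_eq_sum_single x, map_sum]
  refine Commute.sum_right _ _ _ fun i _ => ?_
  rw [map_sum]
  refine Commute.sum_right _ _ _ fun j _ => ?_
  have : Matrix.single i j (x i j) = x i j • Matrix.single i j (1 : L) := by simp
  rw [this, map_smul]
  exact (hsingle i j).smul_right _

/-! ### Central simple algebras -/

/-- The identity is bilinear in `x` and `y`, so it survives scalar extension. For `a = 1` it says
that `T` preserves Jordan products, up to a factor of two. -/
theorem baseChange_jordan_factor {K L B : Type*} [Field K] [Field L] [Algebra K L] [Ring B]
    [Algebra K B] (T : B →ₗ[K] B) (a : B)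
    (hT : ∀ x y, 2 * (T x * T y + T y * T x) = a * T (x * y + y * x) + T (x * y + y * x) * a)
    (x y : L ⊗[K] B) :
    2 * (T.baseChange L x * T.baseChange L y + T.baseChange L y * T.baseChange L x) =
      (1 ⊗ₜ a) * T.baseChange L (x * y + y * x) + T.baseChange L (x * y + y * x) * (1 ⊗ₜ a) := by
  induction x with
  | zero => simp
  | add x x' hx hx' =>
    simp only [mul_add, add_mul, map_add] at hx hx' ⊢
    linear_combination (norm := noncomm_ring) hx + hx'
  | tmul l x =>
    induction y with
    | zero => simp
    | add y y' hy hy' =>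
      simp only [mul_add, add_mul, map_add] at hy hy' ⊢
      linear_combination (norm := noncomm_ring) hy + hy'
    | tmul m y =>
      simp only [Algebra.TensorProduct.tmul_mul_tmul, LinearMap.baseChange_tmul, mul_comm m l,
        ← TensorProduct.tmul_add, one_mul, mul_one, ← hT]
      rw [two_mul, two_mul, ← TensorProduct.tmul_add]

section CentralSimple

variable {K B : Type*} [Field K] [Ring B] [Algebra K B] [IsSimpleRing B] [Algebra.IsCentral K B]
  [FiniteDimensional K B]

theorem mul_sub_mul_mem_commutatorSpan {F A : Type*} [Field F] [Ring A] [Algebra F A] (x y : A) :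
    x * y - y * x ∈ commutatorSpan F A :=
  Submodule.subset_span ⟨x, y, rfl⟩

/-- Nondegeneracy of the reduced trace form: the trace of the split algebra vanishes on
commutators, and its form `(x, y) ↦ trace (x * y)` is nondegenerate. -/
theorem eq_zero_of_forall_mul_mem_commutatorSpan_of_isCentral {x : B}
    (h : ∀ y, x * y ∈ commutatorSpan K B) : x = 0 := by
  obtain ⟨n, ⟨e⟩⟩ := exists_algEquiv_tensorProduct_matrix K B
  let L := AlgebraicClosure K
  let τ : L ⊗[K] B →ₗ[L] L := Matrix.traceLinearMap (Fin n) L L ∘ₗ e.toLinearMap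
  have hτ (w z : L ⊗[K] B) : τ (w * z) = τ (z * w) := by
    simpa [τ] using Matrix.trace_mul_comm (e w) (e z)
  have hcomm (z : B) (hz : z ∈ commutatorSpan K B) : τ (1 ⊗ₜ z) = 0 := by
    induction hz using Submodule.span_induction with
    | mem z hz =>
      obtain ⟨u, v, rfl⟩ := hz
      rw [TensorProduct.tmul_sub, map_sub, sub_eq_zero]
      simpa using hτ (1 ⊗ₜ u) (1 ⊗ₜ v)
    | zero => simp
    | add u v _ _ hu hv => rw [TensorProduct.tmul_add, map_add, hu, hv, add_zero]
    | smul k u _ hu =>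
      have : (1 : L) ⊗ₜ[K] (k • u) = algebraMap K L k • ((1 : L) ⊗ₜ[K] u) := by
        rw [algebraMap_smul, TensorProduct.tmul_smul]
      rw [this, map_smul, hu, smul_zero]
  have hzero (z : L ⊗[K] B) : τ ((1 ⊗ₜ x) * z) = 0 := by
    induction z with
    | zero => simp
    | add u v hu hv => rw [mul_add, map_add, hu, hv, add_zero]
    | tmul l y =>
      have : (1 : L) ⊗ₜ[K] x * (l ⊗ₜ[K] y) = l • ((1 : L) ⊗ₜ[K] (x * y)) := by
        simp [TensorProduct.smul_tmul']
      rw [this, map_smul, hcomm _ (h y), smul_zero]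
  have he : e (1 ⊗ₜ x) = 0 := Matrix.ext_iff_trace_mul_right.2 fun w => by
    simpa [τ] using hzero (e.symm w)
  have h1 : (1 : L) ⊗ₜ[K] x = 0 := by simpa using he
  refine Algebra.TensorProduct.includeRight_injective (R := K) (A := L) (B := B)
    (algebraMap K L).injective ?_
  simpa using h1

/-- A bijective linear Jordan homomorphism preserves the reduced trace. Here this is expressed
without it: a functional vanishing on commutators becomes, after splitting, a multiple of the
trace of matrices. -/
theorem sub_mem_commutatorSpan_of_jordan_of_isCentral (h2 : (2 : K) ≠ 0) (J : B →ₗ[K] B)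
    (hJ : Function.Bijective J) (hmul : ∀ x y, J (x * y + y * x) = J x * J y + J y * J x) (x : B) :
    J x - x ∈ commutatorSpan K B := by
  by_contra hx
  obtain ⟨f, hfx, hf⟩ := Submodule.exists_le_ker_of_notMem hx
  obtain ⟨n, ⟨e⟩⟩ := exists_algEquiv_tensorProduct_matrix K B
  let L := AlgebraicClosure K
  have h2L : (2 : L) ≠ 0 := by
    rw [← map_ofNat (algebraMap K L) 2]
    exact (map_ne_zero _).2 h2
  let f' : L ⊗[K] B →ₗ[L] L := (TensorProduct.AlgebraTensorModule.rid K L L).toLinearMap ∘ₗ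
    f.baseChange L
  have hf' (w z : L ⊗[K] B) : f' (w * z) = f' (z * w) := by
    induction w with
    | zero => simp
    | add u v hu hv => rw [add_mul, mul_add, map_add, map_add, hu, hv]
    | tmul l u =>
      induction z with
      | zero => simp
      | add u v hu hv => rw [add_mul, mul_add, map_add, map_add, hu, hv]
      | tmul m v =>
        have h := hf (mul_sub_mul_mem_commutatorSpan u v)
        rw [LinearMap.mem_ker, map_sub, sub_eq_zero] at h
        simp [f', h, mul_comm l m]
  obtain ⟨c, hc⟩ := Matrix.exists_eq_mul_trace (f' ∘ₗ e.symm.toLinearMap) fun w z => by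
    simpa using hf' (e.symm w) (e.symm z)
  let JL : Matrix (Fin n) (Fin n) L →ₗ[L] Matrix (Fin n) (Fin n) L :=
    e.toLinearMap ∘ₗ J.baseChange L ∘ₗ e.symm.toLinearMap
  have hJL : Function.Bijective JL := by
    have : Function.Bijective (J.baseChange L) :=
      ((LinearEquiv.ofBijective J hJ).baseChange K L B B).bijective
    exact e.bijective.comp (this.comp e.symm.bijective)
  have hJmul (w z : Matrix (Fin n) (Fin n) L) : JL (w * z + z * w) = JL w * JL z + JL z * JL w := by
    have h := congr_arg e (baseChange_jordan_factor (L := L) J 1 (fun x y => by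
      rw [hmul, one_mul, mul_one, two_mul]) (e.symm w) (e.symm z))
    rw [← Algebra.TensorProduct.one_def, one_mul, mul_one, ← two_mul] at h
    simp only [map_mul, map_add, map_ofNat] at h
    have h' : (2 : L) • (JL (w * z + z * w)) = (2 : L) • (JL w * JL z + JL z * JL w) := by
      simp only [ofNat_smul_eq_nsmul, nsmul_eq_mul, Nat.cast_ofNat]
      simpa [JL] using h.symm
    exact smul_right_injective _ h2L h'
  have htr := Matrix.trace_map_jordan h2L JL hJL hJmul (e (1 ⊗ₜ x))
  have h1 : f' (1 ⊗ₜ (J x - x)) = 0 := by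
    have := hc (e (1 ⊗ₜ (J x - x)))
    rw [TensorProduct.tmul_sub, map_sub, Matrix.trace_sub] at this
    rw [TensorProduct.tmul_sub]
    simpa [JL] using this.trans (by
      rw [← htr]
      simp [JL])
  apply hfx
  simpa [f'] using h1

/-- After splitting, involutions span the algebra, which reduces the claim to matrices. -/
theorem commute_sq_of_jordan_factor_of_isCentral (h2 : (2 : K) ≠ 0) (T : B →ₗ[K] B)
    (hT : ∀ x y, 2 * (T x * T y + T y * T x) = T 1 * T (x * y + y * x) + T (x * y + y * x) * T 1)
    (x : B) : Commute (T 1 * T 1) (T x) := by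
  obtain ⟨n, ⟨e⟩⟩ := exists_algEquiv_tensorProduct_matrix K B
  let L := AlgebraicClosure K
  have h2L : (2 : L) ≠ 0 := by
    rw [← map_ofNat (algebraMap K L) 2]
    exact (map_ne_zero _).2 h2
  let TL : Matrix (Fin n) (Fin n) L →ₗ[L] Matrix (Fin n) (Fin n) L :=
    e.toLinearMap ∘ₗ T.baseChange L ∘ₗ e.symm.toLinearMap
  have hTL (z : B) : TL (e (1 ⊗ₜ z)) = e (1 ⊗ₜ T z) := by simp [TL]
  have hTL1 : TL 1 = e (1 ⊗ₜ T 1) := by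
    rw [← hTL, ← Algebra.TensorProduct.one_def, map_one e]
  have h := Matrix.commute_sq_of_jordan_factor h2L TL (fun w z => by
    have h := congr_arg e (baseChange_jordan_factor (L := L) T (T 1) hT (e.symm w) (e.symm z))
    rw [hTL1]
    simp only [two_mul, map_add, map_mul] at h ⊢
    simpa [TL] using h) (e (1 ⊗ₜ x))
  rw [hTL, hTL1, Commute, SemiconjBy, ← map_mul, ← map_mul, ← map_mul, e.injective.eq_iff] at h
  simp only [Algebra.TensorProduct.tmul_mul_tmul, one_mul] at h
  exact Algebra.TensorProduct.includeRight_injective (R := K) (A := L) (B := B)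
    (algebraMap K L).injective h

end CentralSimple

/-! ### Simple algebras -/

theorem mul_mem_commutatorSpan_of_mem_center {F A : Type*} [Field F] [Ring A] [Algebra F A]
    {z x : A} (hz : ∀ y, Commute z y) (hx : x ∈ commutatorSpan F A) :
    z * x ∈ commutatorSpan F A := by
  induction hx using Submodule.span_induction with
  | mem x hx =>
    obtain ⟨u, v, rfl⟩ := hx
    have : z * (u * v - v * u) = (z * u) * v - v * (z * u) := by
      rw [mul_sub, ← mul_assoc, ← mul_assoc, ← mul_assoc, (hz v).eq]
    rw [this]
    exact mul_sub_mul_mem_commutatorSpan _ _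
  | zero => simp
  | add u v _ _ hu hv => rw [mul_add]; exact add_mem hu hv
  | smul k u _ hu => rw [mul_smul_comm]; exact Submodule.smul_mem _ _ hu

/-- The span of the commutators does not depend on the base field. -/
theorem commutatorSpan_mono (K : Type*) {F A : Type*} [Field K] [Field F] [Ring A] [Algebra K A]
    [Algebra F A] {x : A} (hx : x ∈ commutatorSpan K A) : x ∈ commutatorSpan F A := by
  induction hx using Submodule.span_induction with
  | mem x hx => exact Submodule.subset_span hx
  | zero => exact zero_mem _
  | add u v _ _ hu hv => exact add_mem hu hv
  | smul k u _ hu =>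
    rw [Algebra.smul_def]
    exact mul_mem_commutatorSpan_of_mem_center (Algebra.commutes k) hu

/-- A simple algebra is central over its center, which is a field. -/
theorem exists_field_isCentral.{u} (F : Type*) {B : Type u} [Field F] [Ring B] [Algebra F B]
    [IsSimpleRing B] [FiniteDimensional F B] :
    ∃ (K : Type u) (_ : Field K) (_ : Algebra K B),
      Algebra.IsCentral K B ∧ FiniteDimensional K B := by
  let K := (IsSimpleRing.isField_center B).toField
  refine ⟨Subring.center B, K, inferInstance, ⟨fun x hx => ?_⟩, ?_⟩
  · exact ⟨⟨x, Subring.mem_center_iff.2 (Subalgebra.mem_center_iff.1 hx)⟩, rfl⟩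
  · obtain ⟨s, hs⟩ := Module.Finite.fg_top (R := F) (M := B)
    refine ⟨s, eq_top_iff.2 fun x _ => ?_⟩
    have hx : x ∈ Submodule.span F (s : Set B) := hs ▸ trivial
    induction hx using Submodule.span_induction with
    | mem x hx => exact Submodule.subset_span hx
    | zero => exact zero_mem _
    | add u v _ _ hu hv => exact add_mem (hu trivial) (hv trivial)
    | smul k u _ hu =>
      have hk : algebraMap F B k ∈ Subring.center B :=
        Subring.mem_center_iff.2 fun y => (Algebra.commutes k y).symm
      rw [Algebra.smul_def]
      exact Submodule.smul_mem _ (⟨_, hk⟩ : Subring.center B) (hu trivial)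

theorem two_ne_zero_of_algebra (F K : Type*) {B : Type*} [Field F] [Field K] [Ring B]
    [Nontrivial B] [Algebra F B] [Algebra K B] (h2 : (2 : F) ≠ 0) : (2 : K) ≠ 0 := by
  intro h
  refine h2 ((algebraMap F B).injective ?_)
  have := congr_arg (algebraMap K B) h
  rwa [map_ofNat, map_zero] at this ⊢

section Simple

variable {F B : Type*} [Field F] [Ring B] [Algebra F B] [IsSimpleRing B] [FiniteDimensional F B]

theorem eq_zero_of_forall_mul_mem_commutatorSpan_of_isSimpleRing {x : B}
    (h : ∀ y, x * y ∈ commutatorSpan F B) : x = 0 := by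
  obtain ⟨K, _, _, _, _⟩ := exists_field_isCentral F (B := B)
  exact eq_zero_of_forall_mul_mem_commutatorSpan_of_isCentral (K := K) fun y =>
    commutatorSpan_mono F (h y)

theorem sub_mem_commutatorSpan_of_jordan_of_isSimpleRing (h2 : (2 : F) ≠ 0) (J : B →ₗ[F] B)
    (hz : ∀ z, (∀ y, Commute z y) → ∀ x, J (z * x) = z * J x)
    (hJ : Function.Bijective J) (hmul : ∀ x y, J (x * y + y * x) = J x * J y + J y * J x) (x : B) :
    J x - x ∈ commutatorSpan F B := by
  obtain ⟨K, _, _, _, _⟩ := exists_field_isCentral F (B := B)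
  let J' : B →ₗ[K] B :=
    { toFun := J
      map_add' := J.map_add
      map_smul' := fun k x => by
        simp only [Algebra.smul_def]
        exact hz _ (Algebra.commutes k) x }
  exact commutatorSpan_mono K (sub_mem_commutatorSpan_of_jordan_of_isCentral
    (two_ne_zero_of_algebra F K (B := B) h2) J' hJ hmul x)

theorem commute_sq_of_jordan_factor_of_isSimpleRing (h2 : (2 : F) ≠ 0) (T : B →ₗ[F] B)
    (hz : ∀ z, (∀ y, Commute z y) → ∀ x, T (z * x) = z * T x)
    (hT : ∀ x y, 2 * (T x * T y + T y * T x) = T 1 * T (x * y + y * x) + T (x * y + y * x) * T 1)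
    (x : B) : Commute (T 1 * T 1) (T x) := by
  obtain ⟨K, _, _, _, _⟩ := exists_field_isCentral F (B := B)
  let T' : B →ₗ[K] B :=
    { toFun := T
      map_add' := T.map_add
      map_smul' := fun k x => by
        simp only [Algebra.smul_def]
        exact hz _ (Algebra.commutes k) x }
  exact commute_sq_of_jordan_factor_of_isCentral
    (two_ne_zero_of_algebra F K (B := B) h2) T' hT x

theorem mem_multiplicationAlgebra_of_isSimpleRing (f : B →ₗ[F] B)
    (hz : ∀ z, (∀ y, Commute z y) → ∀ x, f (z * x) = z * f x) :
    f ∈ multiplicationAlgebra F B := by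
  obtain ⟨K, _, _, _, _⟩ := exists_field_isCentral F (B := B)
  let f' : B →ₗ[K] B :=
    { toFun := f
      map_add' := f.map_add
      map_smul' := fun k x => by
        simp only [Algebra.smul_def]
        exact hz _ (Algebra.commutes k) x }
  exact (mem_multiplicationAlgebra_iff f).2
    ((mem_multiplicationAlgebra_iff f').1 (mem_multiplicationAlgebra_of_isCentral f'))

end Simple

/-! ### Products of simple algebras -/

section Pi

variable {F A ι : Type*} {B : ι → Type*} [Field F] [Ring A] [Algebra F A] [∀ i, Ring (B i)]
  [∀ i, Algebra F (B i)] (e : A ≃ₐ[F] Π i, B i)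

/-- The projection of an algebra onto the `i`-th factor of a product decomposition. -/
def factorProj (i : ι) : A →ₐ[F] B i :=
  (Pi.evalAlgHom F B i).comp e.toAlgHom

theorem factorProj_mem_commutatorSpan (i : ι) {x : A} (hx : x ∈ commutatorSpan F A) :
    factorProj e i x ∈ commutatorSpan F (B i) := by
  induction hx using Submodule.span_induction with
  | mem x hx =>
    obtain ⟨u, v, rfl⟩ := hx
    simpa using mul_sub_mul_mem_commutatorSpan (F := F) (factorProj e i u) (factorProj e i v)
  | zero => simp
  | add u v _ _ hu hv => rw [map_add]; exact add_mem hu hv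
  | smul k u _ hu => rw [map_smul]; exact Submodule.smul_mem _ _ hu

variable [DecidableEq ι]

/-- The (non-unital) inclusion of the `i`-th factor of a product decomposition. -/
def factorIncl (i : ι) : B i →ₗ[F] A :=
  e.symm.toLinearMap ∘ₗ LinearMap.single F B i

theorem factorProj_factorIncl (i : ι) (y : B i) : factorProj e i (factorIncl e i y) = y := by
  simp [factorProj, factorIncl]

theorem factorIncl_mul (i : ι) (y z : B i) :
    factorIncl e i (y * z) = factorIncl e i y * factorIncl e i z := by
  simp [factorIncl, Pi.single_mul]

theorem factorIncl_mul_eq (i : ι) (y : B i) (x : A) :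
    factorIncl e i y * x = factorIncl e i (y * factorProj e i x) := by
  apply e.injective
  ext j
  by_cases h : j = i
  · subst h; simp [factorIncl, factorProj]
  · simp [factorIncl, h]

theorem mul_factorIncl_eq (i : ι) (y : B i) (x : A) :
    x * factorIncl e i y = factorIncl e i (factorProj e i x * y) := by
  apply e.injective
  ext j
  by_cases h : j = i
  · subst h; simp [factorIncl, factorProj]
  · simp [factorIncl, h]

theorem sum_factorIncl_factorProj [Fintype ι] (x : A) :
    ∑ i, factorIncl e i (factorProj e i x) = x := by
  apply e.injective
  ext j
  simp [factorIncl, factorProj, map_sum]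

theorem commute_factorIncl {i : ι} {z : B i} (hz : ∀ y, Commute z y) (x : A) :
    Commute (factorIncl e i z) x := by
  rw [Commute, SemiconjBy, factorIncl_mul_eq, mul_factorIncl_eq, (hz _).eq]

theorem factorIncl_mem_commutatorSpan (i : ι) {y : B i} (hy : y ∈ commutatorSpan F (B i)) :
    factorIncl e i y ∈ commutatorSpan F A := by
  induction hy using Submodule.span_induction with
  | mem x hx =>
    obtain ⟨u, v, rfl⟩ := hx
    rw [map_sub, factorIncl_mul, factorIncl_mul]
    exact mul_sub_mul_mem_commutatorSpan _ _
  | zero => simp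
  | add u v _ _ hu hv => rw [map_add]; exact add_mem hu hv
  | smul k u _ hu => rw [map_smul]; exact Submodule.smul_mem _ _ hu

/-- The map induced on the `i`-th factor by an endomorphism of the algebra. -/
def factorMap (T : A →ₗ[F] A) (i : ι) : B i →ₗ[F] B i :=
  (factorProj e i).toLinearMap ∘ₗ T ∘ₗ factorIncl e i

variable {e} {T : A →ₗ[F] A}

/-- A map that is linear over the center respects the central idempotents, hence acts factor by
factor. -/
theorem factorProj_apply
    (hz : ∀ z, (∀ y, Commute z y) → ∀ x, T (z * x) = z * T x) (i : ι) (x : A) :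
    factorProj e i (T x) = factorMap e T i (factorProj e i x) := by
  have h := hz _ (commute_factorIncl e (i := i) (z := 1) fun y => Commute.one_left y) x
  rw [factorIncl_mul_eq, one_mul] at h
  simp [factorMap, h, factorProj_factorIncl]

theorem factorMap_center_linear
    (hz : ∀ z, (∀ y, Commute z y) → ∀ x, T (z * x) = z * T x) (i : ι) (z : B i)
    (hzi : ∀ y, Commute z y) (x : B i) :
    factorMap e T i (z * x) = z * factorMap e T i x := by
  simp [factorMap, factorIncl_mul, hz _ (commute_factorIncl e hzi), factorProj_factorIncl]

theorem factorMap_surjective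
    (hz : ∀ z, (∀ y, Commute z y) → ∀ x, T (z * x) = z * T x) (i : ι)
    (hT : Function.Surjective T) :
    Function.Surjective (factorMap e T i) := fun y => by
  obtain ⟨x, hx⟩ := hT (factorIncl e i y)
  exact ⟨factorProj e i x, by rw [← factorProj_apply hz, hx, factorProj_factorIncl]⟩

end Pi

/-! ### Semisimple algebras -/

theorem exists_algEquiv_pi_isSimpleRing.{u} (F : Type*) (A : Type u) [Field F] [Ring A]
    [Algebra F A]
    [FiniteDimensional F A] [IsSemisimpleRing A] :
    ∃ (n : ℕ) (B : Fin n → Type u) (_ : ∀ i, Ring (B i)) (_ : ∀ i, Algebra F (B i)),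
      (∀ i, IsSimpleRing (B i)) ∧ (∀ i, FiniteDimensional F (B i)) ∧
        Nonempty (A ≃ₐ[F] Π i, B i) := by
  obtain ⟨n, D, d, _, _, _, hd, ⟨e⟩⟩ :=
    IsSemisimpleRing.exists_algEquiv_pi_matrix_divisionRing_finite F A
  exact ⟨n, fun i => Matrix (Fin (d i)) (Fin (d i)) (D i), inferInstance, inferInstance,
    fun i => inferInstance, fun i => inferInstance, ⟨e⟩⟩

section Semisimple

variable {F A : Type*} [Field F] [Ring A] [Algebra F A] [FiniteDimensional F A]
  [IsSemisimpleRing A]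

/-- The pairing `(x, y) ↦ x * y` modulo commutators is nondegenerate on a semisimple algebra. -/
theorem eq_zero_of_forall_mul_mem_commutatorSpan {x : A}
    (h : ∀ y, x * y ∈ commutatorSpan F A) : x = 0 := by
  obtain ⟨n, B, _, _, _, _, ⟨e⟩⟩ := exists_algEquiv_pi_isSimpleRing F A
  rw [← sum_factorIncl_factorProj e x]
  refine Finset.sum_eq_zero fun i _ => ?_
  rw [eq_zero_of_forall_mul_mem_commutatorSpan_of_isSimpleRing (F := F)
    (x := factorProj e i x), map_zero]
  intro y
  simpa [factorProj_factorIncl] using factorProj_mem_commutatorSpan e i (h (factorIncl e i y))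

theorem sub_mem_commutatorSpan_of_jordan (h2 : (2 : F) ≠ 0) {J : A →ₗ[F] A}
    (hz : ∀ z, (∀ y, Commute z y) → ∀ x, J (z * x) = z * J x)
    (hJ : IsJordanAutomorphism J) (x : A) : J x - x ∈ commutatorSpan F A := by
  obtain ⟨n, B, _, _, _, _, ⟨e⟩⟩ := exists_algEquiv_pi_isSimpleRing F A
  rw [← sum_factorIncl_factorProj e (J x - x)]
  refine sum_mem fun i _ => factorIncl_mem_commutatorSpan e i ?_
  rw [map_sub, factorProj_apply hz]
  have hs := factorMap_surjective hz (e := e) i hJ.bijective.2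
  refine sub_mem_commutatorSpan_of_jordan_of_isSimpleRing h2 _ (factorMap_center_linear hz i)
    ⟨LinearMap.injective_iff_surjective.2 hs, hs⟩ (fun u v => ?_) _
  simp only [factorMap, LinearMap.comp_apply, map_add, factorIncl_mul, AlgHom.toLinearMap_apply]
  rw [← map_add, ← map_add, hJ.map_jordan]
  simp

theorem commute_sq_of_jordan_factor (h2 : (2 : F) ≠ 0) {T : A →ₗ[F] A}
    (hz : ∀ z, (∀ y, Commute z y) → ∀ x, T (z * x) = z * T x)
    (hT : ∀ x y, 2 * (T x * T y + T y * T x) = T 1 * T (x * y + y * x) + T (x * y + y * x) * T 1)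
    (x : A) : Commute (T 1 * T 1) (T x) := by
  obtain ⟨n, B, _, _, _, _, ⟨e⟩⟩ := exists_algEquiv_pi_isSimpleRing F A
  have h (i : Fin n) : factorProj e i (T 1 * T 1 * T x) = factorProj e i (T x * (T 1 * T 1)) := by
    have := commute_sq_of_jordan_factor_of_isSimpleRing h2 _
      (factorMap_center_linear hz (e := e) i) (fun u v => by
        have := congr_arg (factorProj e i) (hT (factorIncl e i u) (factorIncl e i v))
        simpa only [two_mul, map_add, map_mul, factorProj_apply hz, factorProj_factorIncl,
          map_one] using this) (factorProj e i x)
    simpa only [map_mul, factorProj_apply hz, map_one] using this.eq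
  rw [Commute, SemiconjBy, ← sum_factorIncl_factorProj e (T 1 * T 1 * T x)]
  simp only [h]
  exact sum_factorIncl_factorProj e _

/-- The multiplication algebra of a semisimple algebra consists of all maps that are linear over
the center. -/
theorem mem_multiplicationAlgebra_of_center_linear {f : A →ₗ[F] A}
    (hz : ∀ z, (∀ y, Commute z y) → ∀ x, f (z * x) = z * f x) :
    f ∈ multiplicationAlgebra F A := by
  obtain ⟨n, B, _, _, _, _, ⟨e⟩⟩ := exists_algEquiv_pi_isSimpleRing F A
  have hf : f = ∑ i, factorIncl e i ∘ₗ factorMap e f i ∘ₗ (factorProj e i).toLinearMap := by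
    ext x
    rw [← sum_factorIncl_factorProj e (f x)]
    simp [factorProj_apply hz]
  rw [hf]
  refine sum_mem fun i _ => ?_
  obtain ⟨m, a, b, hab⟩ := (mem_multiplicationAlgebra_iff _).1
    (mem_multiplicationAlgebra_of_isSimpleRing _ (factorMap_center_linear hz (e := e) i))
  refine (mem_multiplicationAlgebra_iff _).2
    ⟨m, fun j => factorIncl e i (a j), fun j => factorIncl e i (b j), fun x => ?_⟩
  simp [hab, factorIncl_mul_eq, factorProj_factorIncl, map_sum]

end Semisimple

/-! ### Maps preserving cubes modulo commutators -/

section Cubes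

variable {F A : Type*} [Field F] [Ring A] [Algebra F A] {T : A →ₗ[F] A}

/-- The polarization of the cubic condition. Modulo commutators, the sum of the six products of
`u`, `v`, `w` in all orders is `3 * (u * v + v * u) * w`. -/
theorem polarization_mem_commutatorSpan (h3 : (3 : F) ≠ 0)
    (h : ∀ x : A, T x ^ 3 - x ^ 3 ∈ commutatorSpan F A) (x y z : A) :
    (T x * T y + T y * T x) * T z - (x * y + y * x) * z ∈ commutatorSpan F A := by
  have hsymm (u v w : A) :
      u * v * w + v * u * w + u * w * v + w * u * v + v * w * u + w * v * u -
        3 * ((u * v + v * u) * w) ∈ commutatorSpan F A := by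
    have hc := add_mem (add_mem (add_mem
      (mul_sub_mul_mem_commutatorSpan (F := F) (u * w) v)
      (mul_sub_mul_mem_commutatorSpan (F := F) w (u * v)))
      (mul_sub_mul_mem_commutatorSpan (F := F) (v * w) u))
      (mul_sub_mul_mem_commutatorSpan (F := F) w (v * u))
    convert hc using 1
    noncomm_ring
  rw [← Submodule.smul_mem_iff _ h3]
  -- The third difference of the cubic condition is the sum over all orders.
  have hQ := sub_mem (add_mem (add_mem (add_mem (h (x + y + z)) (h x)) (h y)) (h z))
    (add_mem (add_mem (h (x + y)) (h (x + z))) (h (y + z)))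
  have hfin := add_mem (sub_mem hQ (hsymm (T x) (T y) (T z))) (hsymm x y z)
  convert hfin using 1
  simp only [map_add, ofNat_smul_eq_nsmul]
  noncomm_ring

end Cubes

section Forward

variable {F A : Type*} [Field F] [Ring A] [Algebra F A] [FiniteDimensional F A]
  [IsSemisimpleRing A] {T : A →ₗ[F] A}

/-- The polarized condition at `(x, 1, z)` reads `(T x * T 1 + T 1 * T x) * T z ≡ 2 * x * z`, so
nondegeneracy makes Jordan multiplication by `T 1` injective on the range of `T`. -/
theorem eq_zero_of_jordan_apply_one_eq_zero (h2 : (2 : F) ≠ 0)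
    (hp : ∀ x y z : A,
      (T x * T y + T y * T x) * T z - (x * y + y * x) * z ∈ commutatorSpan F A) {x : A}
    (hx : T x * T 1 + T 1 * T x = 0) : x = 0 := by
  refine eq_zero_of_forall_mul_mem_commutatorSpan (F := F) fun y => ?_
  have h := neg_mem (hp x 1 y)
  rw [hx, zero_mul, zero_sub, neg_neg, mul_one, one_mul, add_mul, ← two_smul F] at h
  exact (Submodule.smul_mem_iff _ h2).1 h

theorem bijective_of_polarization (h2 : (2 : F) ≠ 0)
    (hp : ∀ x y z : A,
      (T x * T y + T y * T x) * T z - (x * y + y * x) * z ∈ commutatorSpan F A) :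
    Function.Bijective T := by
  have hinj : Function.Injective T := (injective_iff_map_eq_zero T).2 fun x hx =>
    eq_zero_of_jordan_apply_one_eq_zero h2 hp (by rw [hx, zero_mul, mul_zero, add_zero])
  exact ⟨hinj, LinearMap.injective_iff_surjective.1 hinj⟩

/-- Central linearity is not assumed. It follows because `commutatorSpan` is stable under
multiplication by central elements and the trace pairing is nondegenerate. -/
theorem map_central_mul_of_polarization (h2 : (2 : F) ≠ 0)
    (hp : ∀ x y z : A,
      (T x * T y + T y * T x) * T z - (x * y + y * x) * z ∈ commutatorSpan F A)
    (c : A) (hc : ∀ y, Commute c y) (x : A) : T (c * x) = c * T x := by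
  obtain ⟨y, hy⟩ := (bijective_of_polarization h2 hp).2 (c * T x)
  suffices y - c * x = 0 by rw [← hy, sub_eq_zero.1 this]
  refine eq_zero_of_forall_mul_mem_commutatorSpan (F := F) fun t => ?_
  have h := sub_mem (mul_mem_commutatorSpan_of_mem_center hc (hp x 1 t)) (hp y 1 t)
  rw [← Submodule.smul_mem_iff _ h2]
  convert h using 1
  rw [hy, two_smul]
  linear_combination (norm := noncomm_ring) (-1) * (hc (T 1)).eq * T x * T t

/-- The trace pairings of the two sides with `T z` agree modulo commutators, and `T` is
surjective. -/
theorem jordan_factor_of_polarization (h2 : (2 : F) ≠ 0)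
    (hp : ∀ x y z : A,
      (T x * T y + T y * T x) * T z - (x * y + y * x) * z ∈ commutatorSpan F A) (x y : A) :
    2 * (T x * T y + T y * T x) = T 1 * T (x * y + y * x) + T (x * y + y * x) * T 1 := by
  rw [← sub_eq_zero]
  refine eq_zero_of_forall_mul_mem_commutatorSpan (F := F) fun v => ?_
  obtain ⟨z, rfl⟩ := (bijective_of_polarization h2 hp).2 v
  have h := sub_mem (add_mem (hp x y z) (hp x y z)) (hp 1 (x * y + y * x) z)
  convert h using 1
  noncomm_ring

/-- Centrality of `T 1`: its square is central, and Jordan multiplication by `T 1` is injective. -/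
theorem commute_apply_one_of_polarization (h2 : (2 : F) ≠ 0)
    (hp : ∀ x y z : A,
      (T x * T y + T y * T x) * T z - (x * y + y * x) * z ∈ commutatorSpan F A) (y : A) :
    Commute (T 1) y := by
  have hsurj := (bijective_of_polarization h2 hp).2
  have hsq : Commute (T 1 * T 1) y := by
    obtain ⟨x, rfl⟩ := hsurj y
    exact commute_sq_of_jordan_factor h2 (map_central_mul_of_polarization h2 hp)
      (jordan_factor_of_polarization h2 hp) x
  obtain ⟨x, hx⟩ := hsurj (T 1 * y - y * T 1)
  have h0 : x = 0 := eq_zero_of_jordan_apply_one_eq_zero h2 hp (by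
    rw [hx]
    linear_combination (norm := noncomm_ring) hsq.eq)
  rw [h0, map_zero] at hx
  exact (sub_eq_zero.1 hx.symm)

theorem exists_central_inverse_of_polarization (h2 : (2 : F) ≠ 0)
    (hp : ∀ x y z : A,
      (T x * T y + T y * T x) * T z - (x * y + y * x) * z ∈ commutatorSpan F A) :
    ∃ b : A, T 1 * b = 1 ∧ ∀ y, Commute b y := by
  have hcomm := commute_apply_one_of_polarization h2 hp
  have hinj : Function.Injective (LinearMap.mulLeft F (T 1)) :=
    (injective_iff_map_eq_zero _).2 fun w hw => by
      rw [LinearMap.mulLeft_apply] at hw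
      obtain ⟨x, rfl⟩ := (bijective_of_polarization h2 hp).2 w
      rw [eq_zero_of_jordan_apply_one_eq_zero h2 hp (x := x)
        (by rw [← (hcomm (T x)).eq, hw, add_zero]), map_zero]
  obtain ⟨b, hb⟩ := LinearMap.injective_iff_surjective.1 hinj 1
  rw [LinearMap.mulLeft_apply] at hb
  refine ⟨b, hb, fun y => hinj ?_⟩
  rw [LinearMap.mulLeft_apply, LinearMap.mulLeft_apply, ← mul_assoc, hb, one_mul, ← mul_assoc,
    (hcomm y).eq, mul_assoc, hb, mul_one]

end Forward

theorem IsJordanAutomorphism.map_pow_three {F A : Type*} [Field F] [Ring A] [Algebra F A]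
    {J : A →ₗ[F] A} (hJ : IsJordanAutomorphism J) (h2 : (2 : F) ≠ 0) (x : A) :
    J (x ^ 3) = J x ^ 3 := by
  have hsq : J (x * x) = J x * J x := by
    have h := hJ.map_jordan x x
    rw [map_add, ← two_smul F, ← two_smul F (J x * J x)] at h
    exact smul_right_injective _ h2 h
  have h := hJ.map_jordan x (x * x)
  rw [hsq, map_add, mul_assoc, ← mul_assoc (J x), mul_assoc (J x), ← two_smul F, ← two_smul F] at h
  have := smul_right_injective _ h2 h
  simpa [pow_succ, mul_assoc] using this

/-! ### The characterization -/

theorem theorem3p3 {F A : Type*} [Field F] [Ring A] [Algebra F A] [FiniteDimensional F A]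
    [IsSemisimpleRing A] (h2 : ringChar F ≠ 2) (h3 : ringChar F ≠ 3) (T : A →ₗ[F] A) :
    (∀ x : A, T x ^ 3 - x ^ 3 ∈ commutatorSpan F A) ↔
      ∃ (J : A →ₗ[F] A) (α : A),
        IsJordanAutomorphism J ∧ J ∈ multiplicationAlgebra F A ∧
        α ∈ Subalgebra.center F A ∧ α ^ 3 = 1 ∧ ∀ x : A, T x = α * J x := by
  replace h2 : (2 : F) ≠ 0 := Ring.two_ne_zero h2
  replace h3 : (3 : F) ≠ 0 := fun h => by
    have hd : ringChar F ∣ 3 := ringChar.dvd (by exact_mod_cast h)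
    exact ((Nat.dvd_prime Nat.prime_three).1 hd).elim CharP.ringChar_ne_one h3
  constructor
  · intro h
    have hp := polarization_mem_commutatorSpan h3 h
    have hbij := bijective_of_polarization h2 hp
    have hcomm := commute_apply_one_of_polarization h2 hp
    obtain ⟨b, hab, hb⟩ := exists_central_inverse_of_polarization h2 hp
    let J : A →ₗ[F] A := LinearMap.mulLeft F b ∘ₗ T
    have hTJ (x : A) : T x = T 1 * J x := by
      simp only [J, LinearMap.comp_apply, LinearMap.mulLeft_apply]
      rw [← mul_assoc, hab, one_mul]
    have hinj : Function.Injective J := (injective_iff_map_eq_zero J).2 fun x hx => by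
      have := hTJ x
      rw [hx, mul_zero] at this
      exact (map_eq_zero_iff T hbij.1).1 this
    have hJ : IsJordanAutomorphism J := by
      refine ⟨⟨hinj, LinearMap.injective_iff_surjective.1 hinj⟩, fun x y => ?_⟩
      have hf := jordan_factor_of_polarization h2 hp x y
      rw [← (hcomm _).eq, ← two_mul, hTJ x, hTJ y, hTJ (x * y + y * x)] at hf
      -- Cancel `2 * T 1 * T 1`, the common factor of both sides.
      refine smul_right_injective _ h2 ?_
      have e1 : 2 * (T 1 * T 1 * (J x * J y + J y * J x)) =
          2 * (T 1 * T 1 * J (x * y + y * x)) := by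
        linear_combination (norm := noncomm_ring) hf + 2 * T 1 * (hcomm (J x)).eq * J y +
          2 * T 1 * (hcomm (J y)).eq * J x
      have e2 (w : A) : b * b * (2 * (T 1 * T 1 * w)) = (2 : F) • w := by
        have : b * T 1 = 1 := by rw [(hb _).eq, hab]
        rw [ofNat_smul_eq_nsmul, nsmul_eq_mul, Nat.cast_ofNat]
        linear_combination (norm := noncomm_ring) 2 * b * this * T 1 * w + 2 * this * w
      simp only
      rw [← e2, ← e2, e1]
    have hz : ∀ z, (∀ y, Commute z y) → ∀ x, J (z * x) = z * J x := fun z hz x => by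
      simp only [J, LinearMap.comp_apply, LinearMap.mulLeft_apply]
      rw [map_central_mul_of_polarization h2 hp z hz, ← mul_assoc, (hb z).eq, mul_assoc]
    refine ⟨J, T 1, hJ, mem_multiplicationAlgebra_of_center_linear hz,
      Subalgebra.mem_center_iff.2 fun y => (hcomm y).eq.symm, ?_, hTJ⟩
    rw [← sub_eq_zero]
    refine eq_zero_of_forall_mul_mem_commutatorSpan (F := F) fun y => ?_
    obtain ⟨z, rfl⟩ := hJ.bijective.2 y
    -- Modulo commutators, `T 1 ^ 3 * J z = T 1 * T 1 * T z` is `z`, and so is `J z`.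
    rw [← Submodule.smul_mem_iff _ h2]
    have h1 := sub_mem (hp 1 1 z)
      (Submodule.smul_mem _ (2 : F) (sub_mem_commutatorSpan_of_jordan h2 hz hJ z))
    convert h1 using 1
    rw [hTJ z]
    simp only [ofNat_smul_eq_nsmul]
    noncomm_ring
  · rintro ⟨J, α, hJ, hM, hα, hα3, hT⟩ x
    have hz : ∀ z, (∀ y, Commute z y) → ∀ x, J (z * x) = z * J x := fun z hz x => by
      obtain ⟨n, a, b, h⟩ := (mem_multiplicationAlgebra_iff J).1 hM
      rw [h, h, Finset.mul_sum]
      refine Finset.sum_congr rfl fun i _ => ?_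
      rw [← mul_assoc, ← (hz (a i)).eq, mul_assoc, mul_assoc, mul_assoc]
    have hc : Commute α (J x) := ((Subalgebra.mem_center_iff.1 hα) (J x)).symm
    rw [hT, hc.mul_pow, hα3, one_mul, ← hJ.map_pow_three h2]
    exact sub_mem_commutatorSpan_of_jordan h2 hz hJ _
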